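/- Let $G$ be a finite group. A minimal generating set of $G$ is a subset of $G$ that generates $G$ and has no proper subset generating $G$. The global generating hypergraph $\Delta(G)$ has the elements of $G$ as its vertices and all minimal generating sets of $G$ as its hyperedges. A vertex is isolated if it lies in no hyperedge. A path between two distinct vertices $x_1$ and $x_k$ of a hypergraph is a sequence $x_1,e_1,x_2,\dots,e_{k-1},x_k$, where $x_1,\dots,x_k$ are distinct vertices, $e_1,\dots,e_{k-1}$ are (not necessarily distinct) hyperedges, and $x_j,x_{j+1}\in e_j$ for $1\le j\le k-1$. A hypergraph is connected if any two distinct vertices are joined by a path. Then: 1. the set of isolated vertices of $\Delta(G)$ is the Frattini subgroup of $G$, that is, the intersection of all maximal subgroups of $G$ (and $G$ itself if $G$ is trivial); 2. if $G$ is not cyclic, then the hypergraph $\tilde\Delta(G)$ obtained from $\Delta(G)$ by removing its isolated vertices is connected. -/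

import Mathlib

namespace Hypergraph

/-- The set of isolated vertices: the vertices that lie in no hyperedge. -/
def isolatedVertices {α : Type*} (H : Hypergraph α) : Set α :=
  {x | x ∈ H.vertexSet ∧ H.IsIsolated x}

/-- The hypergraph obtained from `H` by removing its isolated vertices. No hyperedge contains an
isolated vertex, so the hyperedges do not change. -/
def removeIsolated {α : Type*} (H : Hypergraph α) : Hypergraph α where
  vertexSet := H.vertexSet \ H.isolatedVertices
  edgeSet := H.edgeSet
  subset_vertexSet_of_mem_edgeSet' := fun _ he _ hx =>
    ⟨H.subset_vertexSet_of_mem_edgeSet' he hx, fun h => h.2 _ he hx⟩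

/-- A path `x₀, e₀, x₁, …, e_{k-1}, x_k` from `v` to `w`: the vertices are pairwise distinct, the
hyperedges need not be, and `x_j, x_{j+1} ∈ e_j`. For `k = 0` it is the one-vertex path from a
vertex to itself; if `v ≠ w` then `k ≥ 1`. -/
structure Path {α : Type*} (H : Hypergraph α) (v w : α) where
  /-- The number of hyperedges of the path. -/
  length : ℕ
  /-- The vertices of the path. -/
  vert : Fin (length + 1) → α
  /-- The hyperedges of the path. -/
  edge : Fin length → Set α
  vert_mem : ∀ i, vert i ∈ H.vertexSet
  vert_injective : Function.Injective vert
  edge_mem : ∀ j, edge j ∈ H.edgeSet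
  left_mem : ∀ j, vert j.castSucc ∈ edge j
  right_mem : ∀ j, vert j.succ ∈ edge j
  vert_first : vert 0 = v
  vert_last : vert (Fin.last length) = w

/-- A hypergraph is connected if any two of its vertices are joined by a path. -/
def IsConnected {α : Type*} (H : Hypergraph α) : Prop :=
  ∀ v ∈ H.vertexSet, ∀ w ∈ H.vertexSet, Nonempty (H.Path v w)

end Hypergraph

/-- `S` is a minimal generating set of `G`: it generates `G` and no proper subset of it does. -/
def IsMinimalGeneratingSet (G : Type*) [Group G] (S : Set G) : Prop :=
  Minimal (fun T : Set G => Subgroup.closure T = ⊤) S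

/-- The global generating hypergraph `Δ(G)`: the vertices are the elements of `G`, the hyperedges
are all the minimal generating sets of `G`. -/
def globalGeneratingHypergraph (G : Type*) [Group G] : Hypergraph G where
  vertexSet := Set.univ
  edgeSet := {S | IsMinimalGeneratingSet G S}
  subset_vertexSet_of_mem_edgeSet' := fun _ _ => Set.subset_univ _

/-! Given `x` outside a maximal subgroup `M`, choose `A ≤ M` maximal such that `x` and `A` do not
generate `G`. Then `x` shares a minimal generating set with every `m ∈ M \ A`. For a second element
outside `M` there is a similar `B`; since `A` and `B` cannot cover `M`, some `m` is adjacent to both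
elements. For `x ∉ M` and `y ∉ N`, an element outside `M ∪ N` links the two. Part 1 rests on the
Frattini subgroup consisting of non-generators. -/

/-- Two subgroups that do not contain `M` do not cover `M`. -/
theorem Subgroup.exists_mem_notMem_notMem {G : Type*} [Group G] {M H K : Subgroup G}
    (hH : ¬ M ≤ H) (hK : ¬ M ≤ K) : ∃ m ∈ M, m ∉ H ∧ m ∉ K := by
  obtain ⟨a, haM, haH⟩ := SetLike.not_le_iff_exists.1 hH
  obtain ⟨b, hbM, hbK⟩ := SetLike.not_le_iff_exists.1 hK
  by_cases haK : a ∈ K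
  · by_cases hbH : b ∈ H
    · exact ⟨a * b, M.mul_mem haM hbM, fun h => haH ((H.mul_mem_cancel_right hbH).1 h),
        fun h => hbK ((K.mul_mem_cancel_left haK).1 h)⟩
    · exact ⟨b, hbM, hbH, hbK⟩
  · exact ⟨a, haM, haH, haK⟩

section MinimalGeneratingSet

variable {G : Type*} [Group G]

theorem exists_isMinimalGeneratingSet_subset [Finite G] {T : Set G}
    (hT : Subgroup.closure T = ⊤) : ∃ S ⊆ T, IsMinimalGeneratingSet G S :=
  exists_minimal_le_of_wellFoundedLT (fun T : Set G => Subgroup.closure T = ⊤) T hT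

theorem IsMinimalGeneratingSet.notMem_frattini [Finite G] {S : Set G}
    (hS : IsMinimalGeneratingSet G S) {x : G} (hx : x ∈ S) : x ∉ frattini G := by
  intro hxF
  have hle : Subgroup.closure S ≤ Subgroup.closure (S \ {x}) ⊔ frattini G := by
    rw [Subgroup.closure_le]
    intro y hy
    by_cases hyx : y = x
    · exact Subgroup.mem_sup_right (hyx ▸ hxF)
    · exact Subgroup.mem_sup_left (Subgroup.subset_closure ⟨hy, hyx⟩)
  rw [hS.prop, top_le_iff] at hle
  exact (hS.le_of_le (frattini_nongenerating hle) Set.sdiff_subset hx).2 rfl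

/-- A minimal generating set contained in `insert x A` contains `x` if `A` does not generate. -/
theorem IsMinimalGeneratingSet.mem_of_subset_insert {S A : Set G} {x : G}
    (hS : IsMinimalGeneratingSet G S) (hSA : S ⊆ insert x A) (hA : Subgroup.closure A ≠ ⊤) :
    x ∈ S := by
  by_contra hx
  exact hA (top_le_iff.1
    (hS.prop.ge.trans (Subgroup.closure_mono ((Set.subset_insert_iff_of_notMem hx).1 hSA))))

theorem IsCoatom.closure_insert_eq_top {M : Subgroup G} (hM : IsCoatom M) {x : G} (hx : x ∉ M) :
    Subgroup.closure (insert x (M : Set G)) = ⊤ := by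
  refine hM.2 _ (lt_of_le_of_ne
    (fun y hy => Subgroup.subset_closure (Set.mem_insert_of_mem x hy)) ?_)
  intro h
  exact hx (h ▸ Subgroup.subset_closure (Set.mem_insert x _))

theorem exists_isCoatom_notMem_of_notMem_frattini {x : G} (hx : x ∉ frattini G) :
    ∃ M : Subgroup G, IsCoatom M ∧ x ∉ M := by
  by_contra! h
  refine hx ?_
  simp only [frattini, Order.radical, Subgroup.mem_iInf]
  exact h

theorem exists_isMinimalGeneratingSet_mem_of_notMem_frattini [Finite G] {x : G}
    (hx : x ∉ frattini G) : ∃ S, IsMinimalGeneratingSet G S ∧ x ∈ S := by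
  obtain ⟨M, hM, hxM⟩ := exists_isCoatom_notMem_of_notMem_frattini hx
  obtain ⟨S, hSM, hS⟩ := exists_isMinimalGeneratingSet_subset (hM.closure_insert_eq_top hxM)
  exact ⟨S, hS, hS.mem_of_subset_insert hSM (by rw [Subgroup.closure_eq]; exact hM.1)⟩

/-- If `x` lies outside a maximal subgroup `M` of a noncyclic group, then all elements of `M`
outside some proper subgroup of `M` share a minimal generating set with `x`. -/
theorem exists_forall_mem_notMem_exists_isMinimalGeneratingSet [Finite G] (hG : ¬ IsCyclic G)
    {M : Subgroup G} (hM : IsCoatom M) {x : G} (hx : x ∉ M) :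
    ∃ A : Subgroup G, ¬ M ≤ A ∧
      ∀ m ∈ M, m ∉ A → ∃ S, IsMinimalGeneratingSet G S ∧ x ∈ S ∧ m ∈ S := by
  let P : Subgroup G → Prop := fun A => A ≤ M ∧ Subgroup.closure (insert x (A : Set G)) ≠ ⊤
  -- Noncyclicity enters only here: `x` alone does not generate `G`.
  have hbot : P ⊥ := by
    refine ⟨bot_le, fun h => hG ?_⟩
    refine (isCyclic_iff_exists_zpowers_eq_top).2 ⟨x, ?_⟩
    rw [← top_le_iff, ← h, Subgroup.closure_le]
    rintro y (rfl | hy)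
    · exact Subgroup.mem_zpowers y
    · rw [Subgroup.mem_bot.1 hy]
      exact one_mem _
  obtain ⟨A, -, hA⟩ := exists_maximal_ge_of_wellFoundedGT P ⊥ hbot
  refine ⟨A, fun h => hA.prop.2 ?_, fun m hmM hmA => ?_⟩
  · rw [le_antisymm hA.prop.1 h]
    exact hM.closure_insert_eq_top hx
  · have hmAM : Subgroup.closure (insert m (A : Set G)) ≤ M :=
      (Subgroup.closure_le M).2 (Set.insert_subset hmM hA.prop.1)
    have htop : Subgroup.closure (insert x (insert m (A : Set G))) = ⊤ := by
      by_contra h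
      -- Otherwise the closure of `insert m A` would satisfy `P`, and maximality of `A` would force
      -- `m ∈ A`.
      refine hmA (hA.le_of_ge (y := Subgroup.closure (insert m (A : Set G))) ⟨hmAM, ?_⟩
        (fun y hy => Subgroup.subset_closure (Set.mem_insert_of_mem m hy))
        (Subgroup.subset_closure (Set.mem_insert m _)))
      refine fun h' => h (top_le_iff.1 (h'.ge.trans ((Subgroup.closure_le _).2 ?_)))
      exact Set.insert_subset (Subgroup.subset_closure (Set.mem_insert x _))
        (Subgroup.closure_mono (Set.subset_insert x _))
    obtain ⟨S, hST, hS⟩ := exists_isMinimalGeneratingSet_subset htop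
    -- Neither element can be dropped: without `x` everything lies in `M`, and without `m` the
    -- choice of `A` prevents generation.
    refine ⟨S, hS, hS.mem_of_subset_insert hST fun h => hM.1 (top_le_iff.1 (h ▸ hmAM)), ?_⟩
    exact hS.mem_of_subset_insert (hST.trans (Set.insert_comm x m _).subset) hA.prop.2

end MinimalGeneratingSet

namespace Hypergraph

variable {α : Type*}

/-- The graph on the same vertices in which distinct vertices of a common hyperedge are adjacent. -/
def cliqueGraph (H : Hypergraph α) : SimpleGraph α where
  Adj a b := a ≠ b ∧ ∃ e ∈ H.edgeSet, a ∈ e ∧ b ∈ e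
  symm := ⟨fun _ _ ⟨hab, e, he, ha, hb⟩ => ⟨hab.symm, e, he, hb, ha⟩⟩
  loopless := ⟨fun _ h => h.1 rfl⟩

theorem cliqueGraph_reachable_of_mem {H : Hypergraph α} {e : Set α} (he : e ∈ H.edgeSet) {a b : α}
    (ha : a ∈ e) (hb : b ∈ e) : H.cliqueGraph.Reachable a b := by
  by_cases hab : a = b
  · exact hab ▸ SimpleGraph.Reachable.refl a
  · exact SimpleGraph.Adj.reachable (G := H.cliqueGraph) ⟨hab, e, he, ha, hb⟩

theorem nonempty_path_of_reachable {H : Hypergraph α} {v w : α} (hv : v ∈ H.vertexSet)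
    (h : H.cliqueGraph.Reachable v w) : Nonempty (H.Path v w) := by
  -- A graph path rather than a walk, so that the vertices are distinct.
  obtain ⟨p, hp⟩ := h.exists_isPath
  have hadj : ∀ j : Fin p.length, H.cliqueGraph.Adj (p.getVert j) (p.getVert (j + 1)) :=
    fun j => p.adj_getVert_succ j.2
  choose e he hl hr using fun j => (hadj j).2
  refine ⟨⟨p.length, fun i => p.getVert i, e, fun i => ?_, fun i j hij => ?_, he, hl, hr,
    p.getVert_zero, p.getVert_length⟩⟩
  -- Vertex `0` needs `hv`, since a path of length zero has no hyperedge.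
  · cases i using Fin.cases with
    | zero => simpa using hv
    | succ j => exact H.subset_vertexSet_of_mem_edgeSet' (he j) (hr j)
  · exact Fin.ext (hp.getVert_injOn (Nat.le_of_lt_succ i.2) (Nat.le_of_lt_succ j.2) hij)

end Hypergraph

section GeneratingHypergraph

variable {G : Type*} [Group G] [Finite G]

theorem isolatedVertices_globalGeneratingHypergraph :
    (globalGeneratingHypergraph G).isolatedVertices = (frattini G : Set G) := by
  ext x
  refine ⟨fun hx => ?_, fun hx => ⟨Set.mem_univ x, fun S hS hxS => ?_⟩⟩
  · by_contra hxF
    obtain ⟨S, hS, hxS⟩ := exists_isMinimalGeneratingSet_mem_of_notMem_frattini hxF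
    exact hx.2 S hS hxS
  · exact IsMinimalGeneratingSet.notMem_frattini hS hxS hx

theorem reachable_of_notMem_isCoatom (hG : ¬ IsCyclic G) {M : Subgroup G} (hM : IsCoatom M)
    {x y : G} (hx : x ∉ M) (hy : y ∉ M) :
    (globalGeneratingHypergraph G).removeIsolated.cliqueGraph.Reachable x y := by
  obtain ⟨A, hMA, hA⟩ := exists_forall_mem_notMem_exists_isMinimalGeneratingSet hG hM hx
  obtain ⟨B, hMB, hB⟩ := exists_forall_mem_notMem_exists_isMinimalGeneratingSet hG hM hy
  obtain ⟨m, hm, hmA, hmB⟩ := Subgroup.exists_mem_notMem_notMem hMA hMB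
  obtain ⟨S, hS, hxS, hmS⟩ := hA m hm hmA
  obtain ⟨T, hT, hyT, hmT⟩ := hB m hm hmB
  exact (Hypergraph.cliqueGraph_reachable_of_mem hS hxS hmS).trans
    (Hypergraph.cliqueGraph_reachable_of_mem hT hmT hyT)

theorem isConnected_removeIsolated_globalGeneratingHypergraph (hG : ¬ IsCyclic G) :
    (globalGeneratingHypergraph G).removeIsolated.IsConnected := by
  intro x hx y hy
  refine Hypergraph.nonempty_path_of_reachable hx ?_
  have hx' := hx.2
  have hy' := hy.2
  rw [isolatedVertices_globalGeneratingHypergraph] at hx' hy'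
  obtain ⟨M, hM, hxM⟩ := exists_isCoatom_notMem_of_notMem_frattini hx'
  obtain ⟨N, hN, hyN⟩ := exists_isCoatom_notMem_of_notMem_frattini hy'
  -- The covering lemma with `⊤` as the covered subgroup.
  obtain ⟨z, -, hzM, hzN⟩ := Subgroup.exists_mem_notMem_notMem
    (fun h => hM.1 (top_le_iff.1 h)) (fun h => hN.1 (top_le_iff.1 h))
  exact (reachable_of_notMem_isCoatom hG hM hxM hzM).trans
    (reachable_of_notMem_isCoatom hG hN hzN hyN)

end GeneratingHypergraph

theorem mainTheorem6 (G : Type*) [Group G] [Finite G] :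
    (globalGeneratingHypergraph G).isolatedVertices = (frattini G : Set G) ∧
      (¬ IsCyclic G → (globalGeneratingHypergraph G).removeIsolated.IsConnected) :=
  ⟨isolatedVertices_globalGeneratingHypergraph,
    isConnected_removeIsolated_globalGeneratingHypergraph⟩
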